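/- Let $n\ge 1$ and let $a_0,\dots,a_n$ be positive integers. On $\mathbb C^{n+1}$ with coordinates $z_j=x_j+iy_j$ let $$B=\Big\{z\in\mathbb C^{n+1} : \sum_{j=0}^n|z_j|^2=1,\ \sum_{j=0}^n z_j^{a_j}=0\Big\},\qquad \alpha=\frac14\sum_{j=0}^n a_j\,(x_j\,dy_j-y_j\,dx_j).$$ Then $B$ is a smooth embedded submanifold of dimension $2n-1$, $\alpha$ restricts to a contact form on $B$, and the Reeb vector field of $(B,\alpha)$ (defined by $i_Z\alpha=1$, $i_Zd\alpha=0$) is the restriction to $B$ of $$Z=4i\sum_{j=0}^n\frac1{a_j}\Big(z_j\frac{\partial}{\partial z_j}-\bar z_j\frac{\partial}{\partial\bar z_j}\Big).$$ For a smooth function $f$ on $B$ let $Y_f=fZ+\hat Y_f$ be its contact Hamiltonian vector field, where $\hat Y_f$ is the vector field on $B$ with $\alpha(\hat Y_f)=0$ and $-i_{\hat Y_f}d\alpha=df-Z(f)\alpha$, and let $$[f,g]_B=d\alpha(Y_f,Y_g)+fZ(g)-gZ(f)$$ be the Jacobi bracket. Call finitely many functions on $B$ independent if their differentials are linearly independent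 at each point of an open dense subset of $B$. A set of functions on a $(2N+1)$-dimensional $(M,\alpha)$ is a complete noncommutative set of integrals of the Reeb flow if for some $0\le r\le N$ all its elements are smooth integrals of the Reeb flow ($Z(f)=0$) and it contains $2N-r$ independent functions $g_1,\dots,g_{2N-r}$ with $[g_i,g_j]=0$ for all $i\le 2N-r$ and $j\le r$. The functions $f_j=|z_j|^2$ and $[f_j,f_k]_B$, $j,k=0,\dots,n$, form a complete noncommutative set of integrals of the Reeb flow on $(B,\alpha)$, with $N=n-1$ and $r=0$. In particular, there are $2n-2$ independent functions on $B$ among them. -/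

import Mathlib

open scoped ContDiff

noncomputable section

/-!
# Contact geometry of regular level sets

A submanifold `M` of a finite-dimensional real vector space `E` is given as the zero set of a
smooth map `Φ : E → W` which is a submersion along `M`. Functions, vector fields and the contact
form on `M` are written on `E`, but every notion below depends only on their restriction to `M`
(to tangent vectors of `M`).
-/

namespace ContactLevelSet

section General

variable {E W : Type*} [NormedAddCommGroup E] [NormedSpace ℝ E]
  [NormedAddCommGroup W] [NormedSpace ℝ W]

/-- The level set `M = {z | Φ z = 0}`. -/
def carrier (Φ : E → W) : Set E := {z | Φ z = 0}

/-- `Φ` is smooth and a submersion at each point of `M`: then `M` is an embedded submanifold. -/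
def IsRegular (Φ : E → W) : Prop :=
  ContDiff ℝ ∞ Φ ∧ ∀ z ∈ carrier Φ, Function.Surjective (fderiv ℝ Φ z)

/-- The tangent space `T_z M = ker (dΦ_z)`. -/
def tangent (Φ : E → W) (z : E) : Submodule ℝ E :=
  LinearMap.ker (fderiv ℝ Φ z : E →ₗ[ℝ] W)

/-- `f` is a smooth function on `M`: near each point of `M` it is the restriction of a smooth
function defined on an open subset of `E`. -/
def IsSmoothFunction (Φ : E → W) (f : E → ℝ) : Prop :=
  ∀ z ∈ carrier Φ, ∃ U : Set E, IsOpen U ∧ z ∈ U ∧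
    ∃ g : E → ℝ, ContDiffOn ℝ ∞ g U ∧ Set.EqOn f g (carrier Φ ∩ U)

/-- The differential at `z ∈ M` of a function on `M`, a linear form on `T_z M`. The derivative of
`f` within `M` is determined on the tangent vectors of `M`, and only these are kept. -/
def differential (Φ : E → W) (f : E → ℝ) (z : E) : Module.Dual ℝ (tangent Φ z) :=
  (fderivWithin ℝ f (carrier Φ) z : E →ₗ[ℝ] ℝ).domRestrict (tangent Φ z)

/-- The exterior derivative `dα` of a 1-form `α`, as a function of two vectors. -/
def dForm (α : E → E →L[ℝ] ℝ) (z u v : E) : ℝ :=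
  extDeriv (fun w => ContinuousAlternatingMap.ofSubsingleton ℝ E ℝ (0 : Fin 1) (α w)) z ![u, v]

/-- The (pull-back of the) form `α` is a contact form on `M`, and `dim M = 2 * N + 1`: in this
dimension `α ∧ (dα)^N ≠ 0` at `z` means that `α_z ≠ 0` on `T_z M` and that `dα_z` is nondegenerate
on `ker α_z ⊆ T_z M`. -/
structure IsContactForm (Φ : E → W) (α : E → E →L[ℝ] ℝ) (N : ℕ) : Prop where
  regular : IsRegular Φ
  smooth : ContDiff ℝ ∞ α
  finrank_tangent : ∀ z ∈ carrier Φ, Module.finrank ℝ (tangent Φ z) = 2 * N + 1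
  ne_zero : ∀ z ∈ carrier Φ, ∃ v ∈ tangent Φ z, α z v ≠ 0
  nondegenerate : ∀ z ∈ carrier Φ, ∀ u ∈ tangent Φ z, α z u = 0 →
    (∀ v ∈ tangent Φ z, α z v = 0 → dForm α z u v = 0) → u = 0

/-- `v` is the value at `z` of the Reeb field of `(M, α)`: `i_v α = 1`, `i_v dα = 0` on `T_z M`. -/
def IsReebAt (Φ : E → W) (α : E → E →L[ℝ] ℝ) (z v : E) : Prop :=
  v ∈ tangent Φ z ∧ α z v = 1 ∧ ∀ w ∈ tangent Φ z, dForm α z v w = 0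

/-- The Reeb vector field `Z` of `(M, α)`. -/
def reeb (Φ : E → W) (α : E → E →L[ℝ] ℝ) (z : E) : E :=
  Classical.epsilon (IsReebAt Φ α z)

open Classical in
/-- The derivative of `f` at `z` along a vector `v` tangent to `M`. -/
def deriveAlong (Φ : E → W) (f : E → ℝ) (z v : E) : ℝ :=
  if h : v ∈ tangent Φ z then differential Φ f z ⟨v, h⟩ else 0

/-- `v` is the value at `z` of the horizontal part of the contact Hamiltonian field of `f`:
`v` is tangent to `M`, `α(v) = 0` and `-i_v dα = df - Z(f) α` on `T_z M`. -/
def IsHorizontalHamiltonianAt (Φ : E → W) (α : E → E →L[ℝ] ℝ) (f : E → ℝ) (z v : E) : Prop :=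
  v ∈ tangent Φ z ∧ α z v = 0 ∧ ∀ w ∈ tangent Φ z,
    -dForm α z v w = deriveAlong Φ f z w - deriveAlong Φ f z (reeb Φ α z) * α z w

/-- The contact Hamiltonian vector field `Y_f = f Z + Ŷ_f` of `f` on `(M, α)`. -/
def contactHamiltonian (Φ : E → W) (α : E → E →L[ℝ] ℝ) (f : E → ℝ) (z : E) : E :=
  f z • reeb Φ α z + Classical.epsilon (IsHorizontalHamiltonianAt Φ α f z)

/-- The Jacobi bracket `[f, g] = dα(Y_f, Y_g) + f Z(g) - g Z(f)` of functions on `(M, α)`. -/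
def jacobiBracket (Φ : E → W) (α : E → E →L[ℝ] ℝ) (f g : E → ℝ) (z : E) : ℝ :=
  dForm α z (contactHamiltonian Φ α f z) (contactHamiltonian Φ α g z)
    + f z * deriveAlong Φ g z (reeb Φ α z) - g z * deriveAlong Φ f z (reeb Φ α z)

/-- `f` is a smooth function on `M` with `[1, f] = Z(f) = 0`, an integral of the Reeb flow. -/
def IsReebIntegral (Φ : E → W) (α : E → E →L[ℝ] ℝ) (f : E → ℝ) : Prop :=
  IsSmoothFunction Φ f ∧ ∀ z ∈ carrier Φ, deriveAlong Φ f z (reeb Φ α z) = 0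

/-- The functions `g i` are independent on `M`: their differentials are linearly independent at
each point of an open dense subset of `M`. -/
def AreIndependent (Φ : E → W) {ι : Type*} (g : ι → E → ℝ) : Prop :=
  ∃ U : Set (carrier Φ), IsOpen U ∧ Dense U ∧
    ∀ z ∈ U, LinearIndependent ℝ (fun i => differential Φ (g i) (z : E))

/-- `S` is a complete noncommutative set of integrals of the Reeb flow of the
`(2 * N + 1)`-dimensional `(M, α)`: it consists of integrals, and it contains `2 * N - r`
independent functions the first `r` of which commute with all of them. The regular compact
connected level sets are then tori of dimension `r + 1`. -/
def IsCompleteNoncommutative (Φ : E → W) (α : E → E →L[ℝ] ℝ) (N r : ℕ)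
    (S : Set (E → ℝ)) : Prop :=
  r ≤ N ∧ (∀ f ∈ S, IsReebIntegral Φ α f) ∧
    ∃ g : Fin (2 * N - r) → E → ℝ, (∀ i, g i ∈ S) ∧ AreIndependent Φ g ∧
      ∀ i j : Fin (2 * N - r), (j : ℕ) < r → ∀ z ∈ carrier Φ, jacobiBracket Φ α (g i) (g j) z = 0

end General

end ContactLevelSet

namespace Brieskorn

/-- The defining map `z ↦ (∑ |z_j|² - 1, ∑ z_j ^ a_j)`; its zero set is the Brieskorn manifold. -/
def definingMap {n : ℕ} (a : Fin (n + 1) → ℕ) (z : Fin (n + 1) → ℂ) : ℝ × ℂ :=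
  (∑ j, ‖z j‖ ^ 2 - 1, ∑ j, z j ^ a j)

/-- The 1-form `α = (1/4) ∑ a_j (x_j dy_j - y_j dx_j)`, where `z_j = x_j + i y_j`. -/
def contactForm {n : ℕ} (a : Fin (n + 1) → ℕ) (z : Fin (n + 1) → ℂ) :
    (Fin (n + 1) → ℂ) →L[ℝ] ℝ :=
  (1 / 4 : ℝ) • ∑ j, (a j : ℝ) •
    ((z j).re • (Complex.imCLM.comp (ContinuousLinearMap.proj (R := ℝ) j))
      - (z j).im • (Complex.reCLM.comp (ContinuousLinearMap.proj (R := ℝ) j)))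

/-- The vector field `4 i ∑ (1 / a_j) (z_j ∂/∂z_j - conj z_j ∂/∂(conj z_j))`. -/
def reebField {n : ℕ} (a : Fin (n + 1) → ℕ) (z : Fin (n + 1) → ℂ) : Fin (n + 1) → ℂ :=
  fun j => 4 * Complex.I / (a j : ℂ) * z j

/-- The function `f_j = |z_j|²`. -/
def coordIntegral {n : ℕ} (j : Fin (n + 1)) (z : Fin (n + 1) → ℂ) : ℝ := ‖z j‖ ^ 2

/-- The Jacobi bracket `[f_j, f_k]_B` on the Brieskorn manifold `(B, α)`. -/
def bracketIntegral {n : ℕ} (a : Fin (n + 1) → ℕ) (j k : Fin (n + 1)) :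
    (Fin (n + 1) → ℂ) → ℝ :=
  ContactLevelSet.jacobiBracket (definingMap a) (contactForm a) (coordIntegral j) (coordIntegral k)

/-- The set of all functions `f_j` and `[f_j, f_k]_B`. -/
def integrals {n : ℕ} (a : Fin (n + 1) → ℕ) : Set ((Fin (n + 1) → ℂ) → ℝ) :=
  {f | (∃ j, f = coordIntegral j) ∨ ∃ j k, f = bracketIntegral a j k}

end Brieskorn

end

noncomputable section

open Filter Topology ComplexConjugate

/-!
Write `⟪u, v⟫ = ∑ a_j conj(u_j) v_j`. Then `α_z(v) = Im ⟪z, v⟫ / 4`, `dα(u, v) = Im ⟪u, v⟫ / 2`, and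
`T_z B` is cut out by `Re ⟪w, v⟫ = 0` and `⟪p, v⟫ = 0` with `w_j = z_j / a_j` and
`p_j = conj(z_j ^ (a_j - 1))`. On `B` the real line of `z` and the complex line of `p` span a
complement of `T_z B` that is `dα`-orthogonal to `T_z B ∩ ker α`, so nondegeneracy of `dα` on
`ℂ^(n+1)` passes to `T_z B ∩ ker α`.

Put `P_j = z_j ^ a_j`. Projecting the Hamiltonian field of `f_j` on `ℂ^(n+1)` to `T_z B` gives
`[f_j, f_k] = 8 Im (conj(P_k) P_j) / ⟪p, p⟫`. To see that `2n - 2` of the functions are independent,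
write a tangent vector as `v_j = (ζ_j / a_j) z_j`. If it kills the `f_j` then every `ζ_j` is
imaginary; if it also kills `[f_o, f_k]` and `Re (conj(P_k) P_o) ≠ 0`, then `ζ_k = ζ_o`. When this
holds for all `k` but two, say `r` and `s`, the equations `∑ ζ_j P_j = 0` and `∑ P_j = 0` force
`ζ_r = ζ_s = ζ_o`, provided that `P_r` and `P_s` are linearly independent over `ℝ`. Hence `v` is a
multiple of the Reeb field, and `2n - 2 = dim B - 1` differentials with a common kernel of dimension
at most one are linearly independent.
-/

theorem linearIndependent_of_card_add_finrank_le {K V ι : Type*} [Field K] [AddCommGroup V]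
    [Module K V] [FiniteDimensional K V] [Fintype ι] {L : ι → Module.Dual K V} {p : Submodule K V}
    (hp : ∀ v, (∀ i, L i v = 0) → v ∈ p)
    (hcard : Fintype.card ι + Module.finrank K p ≤ Module.finrank K V) :
    LinearIndependent K L := by
  have hker : (Submodule.span K (Set.range L)).dualCoannihilator ≤ p := fun v hv =>
    hp v fun i => (Submodule.mem_dualCoannihilator v).1 hv _ (Submodule.subset_span ⟨i, rfl⟩)
  have hrank := Subspace.finrank_add_finrank_dualCoannihilator_eq (Submodule.span K (Set.range L))
  have hle := Submodule.finrank_mono hker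
  rw [linearIndependent_iff_card_le_finrank_span, Set.finrank]
  lia

theorem dense_iInter_of_isOpen_of_finite {X : Type*} {ι : Sort*} [TopologicalSpace X] [Finite ι]
    {s : ι → Set X} (ho : ∀ i, IsOpen (s i)) (hd : ∀ i, Dense (s i)) : Dense (⋂ i, s i) :=
  (Set.finite_range s).dense_sInter (Set.forall_mem_range.2 ho) (Set.forall_mem_range.2 hd)

theorem mem_tangentConeAt_of_hasDerivAt {E : Type*} [NormedAddCommGroup E] [NormedSpace ℝ E]
    {s : Set E} {γ : ℝ → E} {v : E} {t : ℝ} (hγ : HasDerivAt γ v t)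
    (hs : ∀ᶠ u in 𝓝 t, γ u ∈ s) : v ∈ tangentConeAt ℝ s (γ t) := by
  have hone : (1 : ℝ) ∈ tangentConeAt ℝ (γ ⁻¹' s) t := by
    rw [tangentConeAt_of_mem_nhds (show γ ⁻¹' s ∈ 𝓝 t from hs)]
    exact Set.mem_univ 1
  have himage := hγ.hasFDerivAt.hasFDerivWithinAt.mapsTo_tangent_cone hone
  exact tangentConeAt_mono (Set.image_preimage_subset γ s) (by simpa using himage)

theorem im_complex_sq (x : ℂ) : (x ^ 2).im = 2 * x.re * x.im := by
  rw [sq, Complex.mul_im]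
  ring

theorem linearIndependent_pair_of_im_ne_zero {x y : ℂ} (h : (conj y * x).im ≠ 0) :
    LinearIndependent ℝ ![x, y] := by
  have hy : y ≠ 0 := by
    rintro rfl
    simp at h
  refine LinearIndependent.pair_iff.2 fun s t hst => ?_
  have hmul : conj y * (s • x + t • y) = s * (conj y * x) + ((t * ‖y‖ ^ 2 : ℝ) : ℂ) := by
    simp only [Complex.real_smul]
    push_cast
    rw [← Complex.conj_mul']
    ring
  have hs : s = 0 := by
    have him := congrArg Complex.im hmul
    rw [hst, mul_zero, Complex.zero_im, Complex.add_im, Complex.im_ofReal_mul, Complex.ofReal_im,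
      add_zero, eq_comm] at him
    exact (mul_eq_zero.1 him).resolve_right h
  subst hs
  simpa [hy] using hst

theorem hasDerivAt_exp_ofReal_mul (c : ℂ) :
    HasDerivAt (fun t : ℝ => Complex.exp (t * c)) c 0 := by
  simpa using (((hasDerivAt_id (0 : ℝ)).ofReal_comp).mul_const c).cexp

namespace ContactLevelSet

variable {E W : Type*} [NormedAddCommGroup E] [NormedSpace ℝ E]
  [NormedAddCommGroup W] [NormedSpace ℝ W] {Φ : E → W} {α : E → E →L[ℝ] ℝ} {N : ℕ}
  {z u v w y y' : E} {f g : E → ℝ}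

theorem mem_tangent_iff : v ∈ tangent Φ z ↔ fderiv ℝ Φ z v = 0 := by
  simp [tangent]

section Regular

variable [CompleteSpace E] [FiniteDimensional ℝ W]

theorem IsRegular.exists_curve (hΦ : IsRegular Φ) (hz : z ∈ carrier Φ) (hv : v ∈ tangent Φ z) :
    ∃ γ : ℝ → E, γ 0 = z ∧ HasDerivAt γ v 0 ∧ ∀ᶠ t in 𝓝 0, γ t ∈ carrier Φ := by
  have hstrict : HasStrictFDerivAt Φ (fderiv ℝ Φ z) z :=
    hΦ.1.contDiffAt.hasStrictFDerivAt (by simp)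
  have hsurj : (fderiv ℝ Φ z).range = ⊤ := LinearMap.range_eq_top.2 (hΦ.2 z hz)
  let v' : (fderiv ℝ Φ z).ker := ⟨v, mem_tangent_iff.1 hv⟩
  have hline : HasDerivAt (fun t : ℝ => t • v') v' 0 := by
    simpa using (hasDerivAt_id (0 : ℝ)).smul_const v'
  have hline0 : Tendsto (fun t : ℝ => t • v') (𝓝 0) (𝓝 0) := by
    simpa using hline.continuousAt.tendsto
  refine ⟨fun t => hstrict.implicitFunction Φ (fderiv ℝ Φ z) hsurj (Φ z) (t • v'), by simp, ?_, ?_⟩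
  · exact (hstrict.to_implicitFunction hsurj).hasFDerivAt.comp_hasDerivAt_of_eq 0 hline
      (zero_smul ℝ v').symm
  · filter_upwards [(tendsto_const_nhds.prodMk_nhds hline0).eventually
      (hstrict.map_implicitFunction_eq hsurj)] with t ht
    exact ht.trans hz

theorem IsRegular.mem_tangentConeAt (hΦ : IsRegular Φ) (hz : z ∈ carrier Φ)
    (hv : v ∈ tangent Φ z) : v ∈ tangentConeAt ℝ (carrier Φ) z := by
  obtain ⟨γ, rfl, hγ, hmem⟩ := hΦ.exists_curve hz hv
  exact mem_tangentConeAt_of_hasDerivAt hγ hmem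

theorem IsRegular.deriveAlong_eq (hΦ : IsRegular Φ) (hz : z ∈ carrier Φ) {f' : E →L[ℝ] ℝ}
    (hf : HasFDerivWithinAt f f' (carrier Φ) z) (hv : v ∈ tangent Φ z) :
    deriveAlong Φ f z v = f' v := by
  rw [deriveAlong, dif_pos hv]
  exact hf.differentiableWithinAt.hasFDerivWithinAt.unique_on hf (hΦ.mem_tangentConeAt hz hv)

/-- Since `fderiv` is zero where `h` is not differentiable, `hs` contains differentiability. -/
theorem IsRegular.dense_ne_zero {F : Type*} [NormedAddCommGroup F] [NormedSpace ℝ F]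
    (hΦ : IsRegular Φ) {h : E → F} {s : Set (carrier Φ)} (hdense : Dense s)
    (hs : ∀ z ∈ s, h z = 0 → ∃ v ∈ tangent Φ (z : E), fderiv ℝ h z v ≠ 0) :
    Dense {x : carrier Φ | h x ≠ 0} := by
  refine dense_closure.1 (hdense.mono fun z hzs => ?_)
  by_cases hz : h z = 0
  swap
  · exact subset_closure hz
  obtain ⟨v, hv, hne⟩ := hs z hzs hz
  have hdiff : DifferentiableAt ℝ h z := by
    by_contra hnot
    simp [fderiv_zero_of_not_differentiableAt hnot] at hne
  obtain ⟨γ, hγ0, hγ, hmem⟩ := hΦ.exists_curve z.2 hv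
  have hcurve : ∀ᶠ t in 𝓝[≠] 0, h (γ t) ≠ 0 :=
    (hdiff.hasFDerivAt.comp_hasDerivAt_of_eq 0 hγ hγ0.symm).eventually_ne hne
  have hlim : Tendsto γ (𝓝[≠] 0) (𝓝 z) := by
    rw [← hγ0]
    exact hγ.continuousAt.tendsto.mono_left nhdsWithin_le_nhds
  rw [Topology.IsInducing.subtypeVal.closure_eq_preimage_closure_image]
  refine mem_closure_of_tendsto hlim ?_
  filter_upwards [hcurve, hmem.filter_mono nhdsWithin_le_nhds] with t hne hmem
  exact ⟨⟨γ t, hmem⟩, hne, rfl⟩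

end Regular

section ExteriorDerivative

theorem dForm_eq_fderiv (hα : DifferentiableAt ℝ α z) (u v : E) :
    dForm α z u v = fderiv ℝ α z u v - fderiv ℝ α z v u := by
  have hform : DifferentiableAt ℝ
      (fun w => ContinuousAlternatingMap.ofSubsingleton ℝ E ℝ (0 : Fin 1) (α w)) z :=
    (ContinuousAlternatingMap.ofSubsingletonLIE (𝕜 := ℝ) (E := E) (F := ℝ)
      (0 : Fin 1)).toContinuousLinearEquiv.differentiableAt.comp z hα
  have heval : ∀ x y : E, fderiv ℝ (fun w => α w x) z y = fderiv ℝ α z y x := fun x y => by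
    rw [fderiv_clm_apply hα (differentiableAt_const x)]
    simp
  rw [dForm, extDeriv_apply hform]
  simp [Fin.sum_univ_two, Fin.removeNth, heval, sub_eq_add_neg]

theorem dForm_swap : dForm α z u v = -dForm α z v u := by
  have h := (extDeriv (fun w => ContinuousAlternatingMap.ofSubsingleton ℝ E ℝ (0 : Fin 1) (α w))
    z).map_swap ![v, u] Fin.zero_ne_one
  have hvec : ![v, u] ∘ Equiv.swap 0 1 = ![u, v] := by
    funext i
    fin_cases i <;> rfl
  rwa [hvec] at h

theorem dForm_sub_smul_left (c : ℝ) :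
    dForm α z (u - c • v) w = dForm α z u w - c * dForm α z v w := by
  rw [sub_eq_add_neg, ← neg_smul, dForm, ContinuousAlternatingMap.vecCons_add,
    ContinuousAlternatingMap.vecCons_smul, ← dForm, ← dForm, smul_eq_mul, neg_mul, sub_eq_add_neg]

theorem dForm_sub_smul_right (c : ℝ) :
    dForm α z w (u - c • v) = dForm α z w u - c * dForm α z w v := by
  rw [dForm_swap, dForm_sub_smul_left, dForm_swap (u := w), dForm_swap (u := w)]
  ring

end ExteriorDerivative

section Contact

variable {R : E}

theorem IsReebAt.dForm_eq_zero_of_forall_horizontal (hR : IsReebAt Φ α z R)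
    (hu : u ∈ tangent Φ z) (h : ∀ v ∈ tangent Φ z, α z v = 0 → dForm α z u v = 0)
    (hv : v ∈ tangent Φ z) : dForm α z u v = 0 := by
  obtain ⟨hRt, hR1, hRd⟩ := hR
  have hhor := h (v - α z v • R) (sub_mem hv (Submodule.smul_mem _ _ hRt)) (by simp [hR1])
  rwa [dForm_sub_smul_right, dForm_swap (u := u) (v := R), hRd u hu, neg_zero, mul_zero,
    sub_zero] at hhor

theorem IsContactForm.eq_of_forall_dForm_eq (h : IsContactForm Φ α N) (hz : z ∈ carrier Φ)
    (hu : u ∈ tangent Φ z) (hv : v ∈ tangent Φ z) (huv : α z u = α z v)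
    (hd : ∀ w ∈ tangent Φ z, dForm α z u w = dForm α z v w) : u = v := by
  refine sub_eq_zero.1 (h.nondegenerate z hz _ (sub_mem hu hv) (by simp [huv]) fun w hw _ => ?_)
  rw [← one_smul ℝ v, dForm_sub_smul_left, one_mul, hd w hw, sub_self]

theorem IsContactForm.reeb_eq (h : IsContactForm Φ α N) (hz : z ∈ carrier Φ)
    (hR : IsReebAt Φ α z R) : reeb Φ α z = R := by
  have hreeb : IsReebAt Φ α z (reeb Φ α z) := Classical.epsilon_spec ⟨R, hR⟩
  exact h.eq_of_forall_dForm_eq hz hreeb.1 hR.1 (hreeb.2.1.trans hR.2.1.symm)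
    fun w hw => (hreeb.2.2 w hw).trans (hR.2.2 w hw).symm

theorem IsContactForm.contactHamiltonian_eq (h : IsContactForm Φ α N) (hz : z ∈ carrier Φ)
    (hR : IsReebAt Φ α z R) (hy : IsHorizontalHamiltonianAt Φ α f z y) :
    contactHamiltonian Φ α f z = f z • R + y := by
  have hepsilon : IsHorizontalHamiltonianAt Φ α f z
      (Classical.epsilon (IsHorizontalHamiltonianAt Φ α f z)) := Classical.epsilon_spec ⟨y, hy⟩
  rw [contactHamiltonian, h.reeb_eq hz hR]
  congr 1
  exact h.eq_of_forall_dForm_eq hz hepsilon.1 hy.1 (hepsilon.2.1.trans hy.2.1.symm)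
    fun w hw => neg_injective ((hepsilon.2.2 w hw).trans (hy.2.2 w hw).symm)

/-- `y` is the value at `z` of a Hamiltonian vector field of `f` for the presymplectic form `dα` on
`M`: `y` is tangent to `M` and `-i_y dα = df` on `T_z M`. It exists only if `Z(f) = 0` at `z`, and
is determined up to multiples of the Reeb vector. -/
def IsPresymplecticHamiltonianAt (Φ : E → W) (α : E → E →L[ℝ] ℝ) (f : E → ℝ) (z y : E) : Prop :=
  y ∈ tangent Φ z ∧ ∀ w ∈ tangent Φ z, -dForm α z y w = deriveAlong Φ f z w

namespace IsPresymplecticHamiltonianAt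

theorem deriveAlong_eq_zero (hy : IsPresymplecticHamiltonianAt Φ α f z y)
    (hR : IsReebAt Φ α z R) : deriveAlong Φ f z R = 0 := by
  rw [← hy.2 R hR.1, dForm_swap, neg_neg, hR.2.2 y hy.1]

theorem isHorizontalHamiltonianAt (hy : IsPresymplecticHamiltonianAt Φ α f z y)
    (h : IsContactForm Φ α N) (hz : z ∈ carrier Φ) (hR : IsReebAt Φ α z R) :
    IsHorizontalHamiltonianAt Φ α f z (y - α z y • R) := by
  refine ⟨sub_mem hy.1 (Submodule.smul_mem _ _ hR.1), by simp [hR.2.1], fun w hw => ?_⟩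
  rw [h.reeb_eq hz hR, hy.deriveAlong_eq_zero hR, ← hy.2 w hw, dForm_sub_smul_left, hR.2.2 w hw]
  ring

theorem contactHamiltonian_eq (hy : IsPresymplecticHamiltonianAt Φ α f z y)
    (h : IsContactForm Φ α N) (hz : z ∈ carrier Φ) (hR : IsReebAt Φ α z R) :
    contactHamiltonian Φ α f z = y - (α z y - f z) • R := by
  rw [h.contactHamiltonian_eq hz hR (hy.isHorizontalHamiltonianAt h hz hR)]
  module

theorem jacobiBracket_eq (hy : IsPresymplecticHamiltonianAt Φ α f z y)
    (hy' : IsPresymplecticHamiltonianAt Φ α g z y') (h : IsContactForm Φ α N)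
    (hz : z ∈ carrier Φ) (hR : IsReebAt Φ α z R) :
    jacobiBracket Φ α f g z = -deriveAlong Φ f z y' := by
  rw [jacobiBracket, hy.contactHamiltonian_eq h hz hR, hy'.contactHamiltonian_eq h hz hR,
    h.reeb_eq hz hR, hy.deriveAlong_eq_zero hR, hy'.deriveAlong_eq_zero hR, dForm_sub_smul_left,
    dForm_sub_smul_right, dForm_sub_smul_right, dForm_swap (u := y) (v := R), hR.2.2 y hy.1,
    hR.2.2 y' hy'.1, hR.2.2 R hR.1, ← hy.2 y' hy'.1]
  ring

end IsPresymplecticHamiltonianAt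

end Contact

end ContactLevelSet

namespace Brieskorn

open ContactLevelSet

section WeightedForm

variable {ι : Type*} {a : ι → ℕ} {z u : ι → ℂ}

/-- The vector `(z_j / a_j)_j`, whose pairing with `v` is half the derivative of `∑ |z_j|²` along
`v`. -/
def weightedPoint (a : ι → ℕ) (z : ι → ℂ) : ι → ℂ :=
  fun j => z j / a j

/-- The gradient `(conj z_j ^ (a_j - 1))_j` of `∑ z_j ^ a_j` with respect to `weightedForm`. -/
def powerGradient (a : ι → ℕ) (z : ι → ℂ) : ι → ℂ :=
  fun j => conj (z j ^ (a j - 1))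

theorem conj_mul_powerGradient (ha : ∀ j, 0 < a j) (j : ι) :
    conj (z j) * powerGradient a z j = conj (z j ^ a j) := by
  rw [powerGradient, ← map_mul, mul_pow_sub_one (ha j).ne']

variable [Fintype ι]

/-- The sesquilinear form `∑ a_j conj(u_j) v_j`. -/
def weightedForm (a : ι → ℕ) : (ι → ℂ) →ₗ⋆[ℂ] (ι → ℂ) →ₗ[ℂ] ℂ :=
  LinearMap.mk₂'ₛₗ (starRingEnd ℂ) (RingHom.id ℂ) (fun u v => ∑ j, (a j : ℂ) * conj (u j) * v j)
    (fun u u' v => by simp [mul_add, add_mul, Finset.sum_add_distrib])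
    (fun c u v => by simp [Finset.mul_sum, mul_left_comm, mul_assoc])
    (fun u v v' => by simp [mul_add, Finset.sum_add_distrib])
    (fun c u v => by simp [Finset.mul_sum, mul_left_comm, mul_assoc])

/-- The square norm of `powerGradient` with respect to `weightedForm`. -/
def gradientSq (a : ι → ℕ) (z : ι → ℂ) : ℝ :=
  ∑ j, (a j : ℝ) * ‖z j ^ (a j - 1)‖ ^ 2

theorem weightedForm_apply (u v : ι → ℂ) :
    weightedForm a u v = ∑ j, (a j : ℂ) * conj (u j) * v j := rfl

theorem weightedForm_conj (u v : ι → ℂ) : conj (weightedForm a u v) = weightedForm a v u := by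
  simp only [weightedForm_apply, map_sum, map_mul, Complex.conj_conj, Complex.conj_natCast]
  exact Finset.sum_congr rfl fun j _ => by ring

theorem im_weightedForm_swap (u v : ι → ℂ) :
    (weightedForm a u v).im = -(weightedForm a v u).im := by
  rw [← weightedForm_conj v u, Complex.conj_im]

theorem weightedForm_self (u : ι → ℂ) :
    weightedForm a u u = ((∑ j, (a j : ℝ) * ‖u j‖ ^ 2 : ℝ) : ℂ) := by
  rw [weightedForm_apply]
  push_cast
  exact Finset.sum_congr rfl fun j _ => by rw [mul_assoc, Complex.conj_mul']

theorem weightedForm_single [DecidableEq ι] (u : ι → ℂ) (j : ι) (c : ℂ) :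
    weightedForm a u (Pi.single j c) = a j * conj (u j) * c := by
  simp [weightedForm_apply, Pi.single_apply]

theorem eq_zero_of_forall_im_weightedForm_eq_zero (ha : ∀ j, 0 < a j)
    (h : ∀ v, (weightedForm a u v).im = 0) : u = 0 := by
  have hself := h (Complex.I • u)
  rw [map_smul, weightedForm_self, smul_eq_mul, Complex.I_mul_im, Complex.ofReal_re,
    Finset.sum_eq_zero_iff_of_nonneg fun j _ => by positivity] at hself
  ext j
  simpa [(ha j).ne'] using hself j (Finset.mem_univ j)

theorem weightedForm_weightedPoint (ha : ∀ j, 0 < a j) (v : ι → ℂ) :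
    weightedForm a (weightedPoint a z) v = ∑ j, conj (z j) * v j := by
  refine Finset.sum_congr rfl fun j _ => ?_
  have haj : (a j : ℂ) ≠ 0 := Nat.cast_ne_zero.2 (ha j).ne'
  simp only [weightedPoint, map_div₀, Complex.conj_natCast]
  field_simp

theorem weightedForm_powerGradient (v : ι → ℂ) :
    weightedForm a (powerGradient a z) v = ∑ j, a j * z j ^ (a j - 1) * v j := by
  simp [weightedForm_apply, powerGradient]

theorem weightedForm_powerGradient_self :
    weightedForm a (powerGradient a z) (powerGradient a z) = gradientSq a z := by
  rw [weightedForm_self]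
  simp [powerGradient, gradientSq]

theorem weightedForm_powerGradient_weightedPoint (ha : ∀ j, 0 < a j) :
    weightedForm a (powerGradient a z) (weightedPoint a z) = ∑ j, z j ^ a j := by
  rw [weightedForm_powerGradient]
  refine Finset.sum_congr rfl fun j _ => ?_
  have haj : (a j : ℂ) ≠ 0 := Nat.cast_ne_zero.2 (ha j).ne'
  rw [← pow_sub_one_mul (ha j).ne' (z j), weightedPoint]
  field_simp

end WeightedForm

section LogarithmicCoordinates

variable {ι : Type*} {a : ι → ℕ} {z ζ : ι → ℂ}

/-- The function `conj(z_k ^ a_k) z_j ^ a_j`, whose imaginary part is the bracket of `f_j` and `f_k`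
up to a positive factor. -/
def mixedPower (a : ι → ℕ) (j k : ι) (z : ι → ℂ) : ℂ :=
  conj (z k ^ a k) * z j ^ a j

/-- The vector with logarithmic coordinates `ζ_j / a_j` at `z`. -/
def logVector (a : ι → ℕ) (z ζ : ι → ℂ) : ι → ℂ :=
  fun j => ζ j / a j * z j

/-- The curve through `z` with constant logarithmic velocity `ζ_j / a_j`. -/
def logCurve (a : ι → ℕ) (z ζ : ι → ℂ) (t : ℝ) : ι → ℂ :=
  fun j => Complex.exp (t * (ζ j / a j)) * z j

theorem exists_eq_logVector (ha : ∀ j, 0 < a j) (hne : ∀ j, z j ≠ 0) (v : ι → ℂ) :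
    ∃ ζ, v = logVector a z ζ := by
  refine ⟨fun j => a j * v j / z j, funext fun j => ?_⟩
  have haj : (a j : ℂ) ≠ 0 := Nat.cast_ne_zero.2 (ha j).ne'
  have hzj := hne j
  rw [logVector]
  field_simp

theorem conj_mul_logVector (j : ι) :
    conj (z j) * logVector a z ζ j = ((‖z j‖ ^ 2 / a j : ℝ) : ℂ) * ζ j := by
  push_cast
  rw [← Complex.conj_mul', logVector]
  ring

theorem logCurve_zero (ζ : ι → ℂ) : logCurve a z ζ 0 = z := by
  ext j
  simp [logCurve]

theorem hasDerivAt_logCurve (ζ : ι → ℂ) :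
    HasDerivAt (logCurve a z ζ) (logVector a z ζ) 0 :=
  hasDerivAt_pi.2 fun j => (hasDerivAt_exp_ofReal_mul (ζ j / a j)).mul_const (z j)

theorem mixedPower_logCurve (ha : ∀ j, 0 < a j) (j k : ι) (ζ : ι → ℂ)
    (t : ℝ) : mixedPower a j k (logCurve a z ζ t) =
      Complex.exp (t * (ζ j + conj (ζ k))) * mixedPower a j k z := by
  have hpow (l : ι) : logCurve a z ζ t l ^ a l = Complex.exp (t * ζ l) * z l ^ a l := by
    have hal : (a l : ℂ) ≠ 0 := Nat.cast_ne_zero.2 (ha l).ne'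
    rw [logCurve, mul_pow, ← Complex.exp_nat_mul]
    congr 2
    field_simp
  rw [mixedPower, hpow, hpow, mixedPower, mul_add, Complex.exp_add, map_mul, ← Complex.exp_conj,
    map_mul, Complex.conj_ofReal]
  ring

variable [Fintype ι]

/-- The rational extension of the bracket `[f_j, f_k]` to a neighbourhood of the Brieskorn
manifold. -/
def bracketFormula (a : ι → ℕ) (j k : ι) (z : ι → ℂ) : ℝ :=
  8 * (mixedPower a j k z).im / gradientSq a z

theorem gradientSq_logCurve (hζ : ∀ j, (ζ j).re = 0) (t : ℝ) :
    gradientSq a (logCurve a z ζ t) = gradientSq a z := by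
  refine Finset.sum_congr rfl fun j _ => ?_
  have hexp : ‖Complex.exp (t * (ζ j / a j))‖ = 1 := by
    rw [Complex.norm_exp, Complex.re_ofReal_mul, Complex.div_natCast_re, hζ, zero_div, mul_zero,
      Real.exp_zero]
  rw [logCurve, mul_pow, norm_mul, norm_pow, hexp, one_pow, one_mul]

theorem contDiff_mixedPower (j k : ι) : ContDiff ℝ ∞ (mixedPower a j k) := by
  have hpow (j : ι) : ContDiff ℝ ∞ fun z : ι → ℂ => z j ^ a j :=
    (contDiff_apply ℝ ℂ j).pow _
  exact (Complex.conjCLE.contDiff.comp (hpow k)).mul (hpow j)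

theorem contDiff_gradientSq : ContDiff ℝ ∞ (gradientSq a) :=
  ContDiff.sum fun j _ => contDiff_const.mul (((contDiff_apply ℝ ℂ j).pow (a j - 1)).norm_sq ℝ)

theorem isOpen_gradientSq_ne_zero : IsOpen {z | gradientSq a z ≠ 0} :=
  isOpen_ne_fun contDiff_gradientSq.continuous continuous_const

theorem contDiffOn_bracketFormula (j k : ι) :
    ContDiffOn ℝ ∞ (bracketFormula a j k) {z | gradientSq a z ≠ 0} :=
  ((contDiff_const.mul (Complex.imCLM.contDiff.comp (contDiff_mixedPower j k))).contDiffOn).div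
    contDiff_gradientSq.contDiffOn fun _ hx => hx

end LogarithmicCoordinates

variable {n : ℕ} {a : Fin (n + 1) → ℕ} {z u v : Fin (n + 1) → ℂ}

section ContactStructure

theorem mem_carrier_iff :
    z ∈ carrier (definingMap a) ↔ ∑ j, ‖z j‖ ^ 2 = 1 ∧ ∑ j, z j ^ a j = 0 := by
  simp [carrier, definingMap, sub_eq_zero]

theorem exists_ne_zero_of_mem_carrier (hz : z ∈ carrier (definingMap a)) : ∃ j, z j ≠ 0 := by
  by_contra! h
  simpa [h] using (mem_carrier_iff.1 hz).1

theorem gradientSq_pos (ha : ∀ j, 0 < a j) (hz : z ∈ carrier (definingMap a)) :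
    0 < gradientSq a z := by
  obtain ⟨j, hj⟩ := exists_ne_zero_of_mem_carrier hz
  refine Finset.sum_pos' (fun i _ => by positivity) ⟨j, Finset.mem_univ j, ?_⟩
  exact mul_pos (Nat.cast_pos.2 (ha j)) (pow_pos (norm_pos_iff.2 (pow_ne_zero _ hj)) 2)

theorem weightedForm_weightedPoint_self (ha : ∀ j, 0 < a j)
    (hz : z ∈ carrier (definingMap a)) : weightedForm a (weightedPoint a z) z = 1 := by
  rw [weightedForm_weightedPoint ha]
  simp only [Complex.conj_mul']
  exact_mod_cast (mem_carrier_iff.1 hz).1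

theorem weightedForm_weightedPoint_powerGradient (ha : ∀ j, 0 < a j)
    (hz : z ∈ carrier (definingMap a)) :
    weightedForm a (weightedPoint a z) (powerGradient a z) = 0 := by
  rw [← weightedForm_conj, weightedForm_powerGradient_weightedPoint ha, (mem_carrier_iff.1 hz).2,
    map_zero]

theorem contDiff_definingMap : ContDiff ℝ ∞ (definingMap a) := by
  have hcoord (j : Fin (n + 1)) : ContDiff ℝ ∞ fun z : Fin (n + 1) → ℂ => z j :=
    contDiff_apply ℝ ℂ j
  exact ((ContDiff.sum fun j _ => (hcoord j).norm_sq ℝ).sub contDiff_const).prodMk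
    (ContDiff.sum fun j _ => (hcoord j).pow _)

theorem fderiv_definingMap (ha : ∀ j, 0 < a j) (v : Fin (n + 1) → ℂ) :
    fderiv ℝ (definingMap a) z v =
      (2 * (weightedForm a (weightedPoint a z) v).re, weightedForm a (powerGradient a z) v) := by
  have hcoord (j : Fin (n + 1)) := hasFDerivAt_apply (𝕜 := ℝ) (F' := fun _ => ℂ) j z
  have hsphere := (HasFDerivAt.fun_sum fun j (_ : j ∈ Finset.univ) =>
    (hcoord j).norm_sq).sub_const 1
  have hpower := HasFDerivAt.fun_sum fun j (_ : j ∈ Finset.univ) => (hcoord j).pow (a j)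
  have hmap : fderiv ℝ (definingMap a) z = _ := (hsphere.prodMk hpower).fderiv
  rw [hmap, weightedForm_weightedPoint ha, weightedForm_powerGradient]
  ext1
  · simp [Complex.inner, mul_comm, ← Finset.sum_mul, ← add_mul]
  · simp

theorem mem_tangent_definingMap_iff (ha : ∀ j, 0 < a j) :
    v ∈ tangent (definingMap a) z ↔ (weightedForm a (weightedPoint a z) v).re = 0 ∧
      weightedForm a (powerGradient a z) v = 0 := by
  rw [mem_tangent_iff, fderiv_definingMap ha]
  simp

/-- The preimage of `y` under the differential of `definingMap a` at `z` in the span of `z` and the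
complex line of `powerGradient a z`. -/
def transversal (a : Fin (n + 1) → ℕ) (z : Fin (n + 1) → ℂ) (y : ℝ × ℂ) : Fin (n + 1) → ℂ :=
  ((y.1 / 2 : ℝ) : ℂ) • z + ((y.2 - (y.1 / 2 : ℝ) * weightedForm a (powerGradient a z) z) /
    gradientSq a z) • powerGradient a z

theorem fderiv_definingMap_transversal (ha : ∀ j, 0 < a j) (hz : z ∈ carrier (definingMap a))
    (y : ℝ × ℂ) : fderiv ℝ (definingMap a) z (transversal a z y) = y := by
  have hp : (gradientSq a z : ℂ) ≠ 0 := Complex.ofReal_ne_zero.2 (gradientSq_pos ha hz).ne'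
  simp only [fderiv_definingMap ha, transversal, map_add, map_smul,
    weightedForm_weightedPoint_self ha hz, weightedForm_weightedPoint_powerGradient ha hz,
    weightedForm_powerGradient_self, smul_eq_mul, mul_one, mul_zero, add_zero, Complex.ofReal_re,
    div_mul_cancel₀ _ hp, add_sub_cancel, mul_div_cancel₀ y.1 (two_ne_zero)]

theorem isRegular_definingMap (ha : ∀ j, 0 < a j) : ContactLevelSet.IsRegular (definingMap a) :=
  ⟨contDiff_definingMap, fun z hz y =>
    ⟨transversal a z y, fderiv_definingMap_transversal ha hz y⟩⟩

theorem contactForm_apply (v : Fin (n + 1) → ℂ) :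
    contactForm a z v = 1 / 4 * (weightedForm a z v).im := by
  simp only [contactForm, weightedForm_apply, Complex.im_sum, smul_apply, smul_eq_mul, sum_apply]
  congr 1
  refine Finset.sum_congr rfl fun j _ => ?_
  simp only [sub_apply, smul_apply, ContinuousLinearMap.comp_apply, smul_eq_mul,
    ContinuousLinearMap.proj_apply, Complex.imCLM_apply, Complex.reCLM_apply,
    Complex.mul_im, Complex.mul_re, Complex.conj_re, Complex.conj_im, Complex.natCast_re,
    Complex.natCast_im]
  ring

/-- The map `z ↦ α_z`, which is linear. -/
def contactFormCLM (a : Fin (n + 1) → ℕ) :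
    (Fin (n + 1) → ℂ) →L[ℝ] (Fin (n + 1) → ℂ) →L[ℝ] ℝ :=
  let x (j : Fin (n + 1)) := Complex.reCLM.comp (ContinuousLinearMap.proj (R := ℝ) j)
  let y (j : Fin (n + 1)) := Complex.imCLM.comp (ContinuousLinearMap.proj (R := ℝ) j)
  (1 / 4 : ℝ) • ∑ j, (a j : ℝ) • ((x j).smulRight (y j) - (y j).smulRight (x j))

theorem coe_contactFormCLM : ⇑(contactFormCLM a) = contactForm a := by
  ext z v
  simp [contactFormCLM, contactForm]

theorem contDiff_contactForm : ContDiff ℝ ∞ (contactForm a) := by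
  rw [← coe_contactFormCLM]
  exact (contactFormCLM a).contDiff

theorem dForm_contactForm (u v : Fin (n + 1) → ℂ) :
    dForm (contactForm a) z u v = 1 / 2 * (weightedForm a u v).im := by
  rw [← coe_contactFormCLM, dForm_eq_fderiv (contactFormCLM a).differentiableAt,
    ContinuousLinearMap.fderiv, coe_contactFormCLM, contactForm_apply, contactForm_apply,
    im_weightedForm_swap v u]
  ring

theorem finrank_tangent (ha : ∀ j, 0 < a j) (hz : z ∈ carrier (definingMap a)) :
    Module.finrank ℝ (tangent (definingMap a) z) + 3 = 2 * (n + 1) := by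
  have hrank := LinearMap.finrank_range_add_finrank_ker
    (fderiv ℝ (definingMap a) z : (Fin (n + 1) → ℂ) →ₗ[ℝ] ℝ × ℂ)
  have hsurj := LinearMap.range_eq_top.2 ((isRegular_definingMap ha).2 z hz)
  have hdim : Module.finrank ℝ (Fin (n + 1) → ℂ) = (n + 1) * 2 := by
    simp [Module.finrank_pi_fintype, Complex.finrank_real_complex]
  have hdim' : Module.finrank ℝ (ℝ × ℂ) = 3 := by
    simp [Complex.finrank_real_complex]
  rw [hsurj, finrank_top, hdim, hdim'] at hrank
  rw [tangent]
  lia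

theorem reebField_eq : reebField a z = (4 * Complex.I) • weightedPoint a z := by
  ext j
  simp only [reebField, weightedPoint, Pi.smul_apply, smul_eq_mul]
  ring

theorem isReebAt_reebField (ha : ∀ j, 0 < a j) (hz : z ∈ carrier (definingMap a)) :
    IsReebAt (definingMap a) (contactForm a) z (reebField a z) := by
  rw [reebField_eq]
  refine ⟨(mem_tangent_definingMap_iff ha).2 ⟨?_, ?_⟩, ?_, fun w hw => ?_⟩
  · rw [map_smul, weightedForm_self, smul_eq_mul, Complex.re_mul_ofReal]
    simp
  · rw [map_smul, weightedForm_powerGradient_weightedPoint ha, (mem_carrier_iff.1 hz).2, smul_zero]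
  · rw [contactForm_apply, map_smul, ← weightedForm_conj, weightedForm_weightedPoint_self ha hz]
    simp
  · rw [dForm_contactForm, map_smulₛₗ]
    simp [((mem_tangent_definingMap_iff ha).1 hw).1]

theorem im_weightedForm_transversal (ha : ∀ j, 0 < a j) (hu : u ∈ tangent (definingMap a) z)
    (hα : contactForm a z u = 0) (y : ℝ × ℂ) :
    (weightedForm a u (transversal a z y)).im = 0 := by
  have hp : weightedForm a u (powerGradient a z) = 0 := by
    rw [← weightedForm_conj, ((mem_tangent_definingMap_iff ha).1 hu).2, map_zero]
  have hz : (weightedForm a u z).im = 0 := by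
    rw [im_weightedForm_swap, neg_eq_zero]
    simpa [contactForm_apply] using hα
  simp [transversal, hp, hz]

theorem isContactForm_contactForm (ha : ∀ j, 0 < a j) :
    IsContactForm (definingMap a) (contactForm a) (n - 1) where
  regular := isRegular_definingMap ha
  smooth := contDiff_contactForm
  finrank_tangent z hz := by
    have := Brieskorn.finrank_tangent ha hz
    lia
  ne_zero z hz := by
    obtain ⟨hR, hR1, -⟩ := isReebAt_reebField ha hz
    exact ⟨_, hR, by simp [hR1]⟩
  nondegenerate z hz u hu hα h := by
    refine eq_zero_of_forall_im_weightedForm_eq_zero ha fun v => ?_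
    have hv : v - transversal a z (fderiv ℝ (definingMap a) z v) ∈ tangent (definingMap a) z := by
      rw [mem_tangent_iff, map_sub, fderiv_definingMap_transversal ha hz, sub_self]
    have huv := (isReebAt_reebField ha hz).dForm_eq_zero_of_forall_horizontal hu h hv
    rw [dForm_contactForm, map_sub, Complex.sub_im, im_weightedForm_transversal ha hu hα,
      sub_zero] at huv
    simpa using huv

end ContactStructure

section Bracket

variable {ζ : Fin (n + 1) → ℂ}

theorem deriveAlong_coordIntegral (ha : ∀ j, 0 < a j) (hz : z ∈ carrier (definingMap a))
    (j : Fin (n + 1)) (hv : v ∈ tangent (definingMap a) z) :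
    deriveAlong (definingMap a) (coordIntegral j) z v = 2 * (conj (z j) * v j).re := by
  have hcoord := hasFDerivAt_apply (𝕜 := ℝ) (F' := fun _ => ℂ) j z
  have hderiv : HasFDerivAt (coordIntegral j) _ z := hcoord.norm_sq
  rw [(isRegular_definingMap ha).deriveAlong_eq hz hderiv.hasFDerivWithinAt hv]
  simp [Complex.inner, mul_comm, ← add_mul]

theorem re_conj_mul_reebField (j : Fin (n + 1)) : (conj (z j) * reebField a z j).re = 0 := by
  have hmul : conj (z j) * reebField a z j = ((4 / a j * ‖z j‖ ^ 2 : ℝ) : ℂ) * Complex.I := by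
    push_cast
    rw [← Complex.conj_mul', reebField]
    ring
  rw [hmul, Complex.re_ofReal_mul, Complex.I_re, mul_zero]

/-- The projection along the complex line of `powerGradient a z` of the Hamiltonian vector field
of `|z_j|²` on `ℂ^(n+1)`; it is tangent to the Brieskorn manifold. -/
def coordHamiltonian (a : Fin (n + 1) → ℕ) (j : Fin (n + 1)) (z : Fin (n + 1) → ℂ) :
    Fin (n + 1) → ℂ :=
  Pi.single j (reebField a z j) - (4 * Complex.I * z j ^ a j / gradientSq a z) • powerGradient a z

theorem coordHamiltonian_mem_tangent (ha : ∀ j, 0 < a j) (hz : z ∈ carrier (definingMap a))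
    (j : Fin (n + 1)) : coordHamiltonian a j z ∈ tangent (definingMap a) z := by
  have hp : (gradientSq a z : ℂ) ≠ 0 := Complex.ofReal_ne_zero.2 (gradientSq_pos ha hz).ne'
  have haj : (a j : ℂ) ≠ 0 := Nat.cast_ne_zero.2 (ha j).ne'
  rw [mem_tangent_definingMap_iff ha, coordHamiltonian]
  constructor
  · rw [map_sub, map_smul, weightedForm_weightedPoint_powerGradient ha hz,
      smul_zero, sub_zero, weightedForm_weightedPoint ha, Complex.re_sum]
    refine Finset.sum_eq_zero fun k _ => ?_
    obtain rfl | hk := eq_or_ne k j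
    · rw [Pi.single_eq_same, re_conj_mul_reebField]
    · rw [Pi.single_eq_of_ne hk, mul_zero, Complex.zero_re]
  · rw [map_sub, map_smul, weightedForm_powerGradient_self, weightedForm_single, powerGradient,
      Complex.conj_conj, ← pow_sub_one_mul (ha j).ne' (z j), smul_eq_mul, div_mul_cancel₀ _ hp,
      reebField]
    field_simp
    ring

theorem isPresymplecticHamiltonianAt_coordHamiltonian (ha : ∀ j, 0 < a j)
    (hz : z ∈ carrier (definingMap a)) (j : Fin (n + 1)) :
    IsPresymplecticHamiltonianAt (definingMap a) (contactForm a) (coordIntegral j) z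
      (coordHamiltonian a j z) := by
  refine ⟨coordHamiltonian_mem_tangent ha hz j, fun v hv => ?_⟩
  have haj : (a j : ℂ) ≠ 0 := Nat.cast_ne_zero.2 (ha j).ne'
  have hform : weightedForm a (coordHamiltonian a j z) v =
      -(4 * (conj (z j) * v j)) * Complex.I := by
    rw [coordHamiltonian, map_sub, map_smulₛₗ, LinearMap.sub_apply, LinearMap.smul_apply,
      ((mem_tangent_definingMap_iff ha).1 hv).2, ← weightedForm_conj, weightedForm_single,
      reebField]
    simp only [map_mul, map_div₀, Complex.conj_I, Complex.conj_conj, map_natCast, map_ofNat,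
      smul_zero, sub_zero]
    field_simp
  rw [deriveAlong_coordIntegral ha hz j hv, dForm_contactForm, hform, Complex.mul_I_im]
  simp only [Complex.neg_re, Complex.mul_re, Complex.re_ofNat, Complex.im_ofNat]
  ring

theorem bracketIntegral_eqOn (ha : ∀ j, 0 < a j) (j k : Fin (n + 1)) :
    Set.EqOn (bracketIntegral a j k) (bracketFormula a j k) (carrier (definingMap a)) := by
  intro z hz
  have hsingle : (conj (z j) * (Pi.single k (reebField a z k) : Fin (n + 1) → ℂ) j).re = 0 := by
    obtain rfl | hjk := eq_or_ne j k
    · rw [Pi.single_eq_same, re_conj_mul_reebField]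
    · rw [Pi.single_eq_of_ne hjk, mul_zero, Complex.zero_re]
  have hgrad : conj (z j) * (4 * Complex.I * z k ^ a k / gradientSq a z * powerGradient a z j) =
      ((4 / gradientSq a z : ℝ) : ℂ) * (Complex.I * conj (mixedPower a j k z)) := by
    rw [mul_left_comm, conj_mul_powerGradient ha, mixedPower, map_mul, Complex.conj_conj]
    push_cast
    ring
  rw [bracketIntegral, (isPresymplecticHamiltonianAt_coordHamiltonian ha hz j).jacobiBracket_eq
    (isPresymplecticHamiltonianAt_coordHamiltonian ha hz k) (isContactForm_contactForm ha) hz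
    (isReebAt_reebField ha hz), deriveAlong_coordIntegral ha hz j
    (coordHamiltonian_mem_tangent ha hz k), coordHamiltonian, Pi.sub_apply, Pi.smul_apply,
    smul_eq_mul, mul_sub, Complex.sub_re, hsingle, hgrad, Complex.re_ofReal_mul, Complex.I_mul_re,
    Complex.conj_im, bracketFormula]
  ring

theorem reebField_eq_logVector : reebField a z = logVector a z fun _ => 4 * Complex.I := rfl

theorem fderiv_apply_logVector {F : Type*} [NormedAddCommGroup F] [NormedSpace ℝ F]
    {f : (Fin (n + 1) → ℂ) → F} {f' : F} (hf : DifferentiableAt ℝ f z)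
    (hf' : HasDerivAt (fun t => f (logCurve a z ζ t)) f' 0) :
    fderiv ℝ f z (logVector a z ζ) = f' :=
  (hf.hasFDerivAt.comp_hasDerivAt_of_eq 0 (hasDerivAt_logCurve ζ) (logCurve_zero ζ).symm).unique hf'

theorem deriveAlong_bracketIntegral_logVector (ha : ∀ j, 0 < a j)
    (hz : z ∈ carrier (definingMap a)) (j k : Fin (n + 1)) (hζ : ∀ j, (ζ j).re = 0)
    (hv : logVector a z ζ ∈ tangent (definingMap a) z) :
    deriveAlong (definingMap a) (bracketIntegral a j k) z (logVector a z ζ) =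
      8 * ((ζ j + conj (ζ k)) * mixedPower a j k z).im / gradientSq a z := by
  have hdiff : DifferentiableAt ℝ (bracketFormula a j k) z :=
    ((contDiffOn_bracketFormula j k).contDiffAt
      (isOpen_gradientSq_ne_zero.mem_nhds (gradientSq_pos ha hz).ne')).differentiableAt (by simp)
  rw [(isRegular_definingMap ha).deriveAlong_eq hz (hdiff.hasFDerivAt.hasFDerivWithinAt.congr
    (bracketIntegral_eqOn ha j k) (bracketIntegral_eqOn ha j k hz)) hv]
  refine fderiv_apply_logVector hdiff ?_
  simp only [bracketFormula, mixedPower_logCurve ha, gradientSq_logCurve hζ]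
  exact ((Complex.imCLM.hasFDerivAt.comp_hasDerivAt (0 : ℝ)
    ((hasDerivAt_exp_ofReal_mul (ζ j + conj (ζ k))).mul_const _)).const_mul 8).div_const _

theorem isReebIntegral_of_mem_integrals (ha : ∀ j, 0 < a j) {f : (Fin (n + 1) → ℂ) → ℝ}
    (hf : f ∈ integrals a) : IsReebIntegral (definingMap a) (contactForm a) f := by
  obtain ⟨j, rfl⟩ | ⟨j, k, rfl⟩ := hf
  · refine ⟨fun z _ => ⟨Set.univ, isOpen_univ, trivial, coordIntegral j,
      ((contDiff_apply ℝ ℂ j).norm_sq ℝ).contDiffOn, fun _ _ => rfl⟩, fun z hz => ?_⟩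
    have hR := isReebAt_reebField ha hz
    rw [(isContactForm_contactForm ha).reeb_eq hz hR]
    exact (isPresymplecticHamiltonianAt_coordHamiltonian ha hz j).deriveAlong_eq_zero hR
  · refine ⟨fun z hz => ⟨_, isOpen_gradientSq_ne_zero (a := a), (gradientSq_pos ha hz).ne',
      bracketFormula a j k, contDiffOn_bracketFormula j k,
      (bracketIntegral_eqOn ha j k).mono Set.inter_subset_left⟩, fun z hz => ?_⟩
    have hR := isReebAt_reebField ha hz
    rw [(isContactForm_contactForm ha).reeb_eq hz hR, reebField_eq_logVector,
      deriveAlong_bracketIntegral_logVector ha hz j k (by simp) hR.1]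
    simp

theorem deriveAlong_coordIntegral_logVector (ha : ∀ j, 0 < a j)
    (hz : z ∈ carrier (definingMap a)) (j : Fin (n + 1))
    (hv : logVector a z ζ ∈ tangent (definingMap a) z) :
    deriveAlong (definingMap a) (coordIntegral j) z (logVector a z ζ) =
      2 * (‖z j‖ ^ 2 / a j * (ζ j).re) := by
  rw [deriveAlong_coordIntegral ha hz j hv, conj_mul_logVector, Complex.re_ofReal_mul]

theorem logVector_mem_tangent_iff (ha : ∀ j, 0 < a j) :
    logVector a z ζ ∈ tangent (definingMap a) z ↔
      ∑ j, ‖z j‖ ^ 2 / a j * (ζ j).re = 0 ∧ ∑ j, ζ j * z j ^ a j = 0 := by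
  have hpow (j : Fin (n + 1)) : a j * z j ^ (a j - 1) * logVector a z ζ j = ζ j * z j ^ a j := by
    have haj : (a j : ℂ) ≠ 0 := Nat.cast_ne_zero.2 (ha j).ne'
    rw [← pow_sub_one_mul (ha j).ne' (z j), logVector]
    field_simp
  simp only [mem_tangent_definingMap_iff ha, weightedForm_weightedPoint ha,
    weightedForm_powerGradient, Complex.re_sum, conj_mul_logVector, Complex.re_ofReal_mul, hpow]

end Bracket

section GenericPoints

variable {j k : Fin (n + 1)}

/-- Generic points of `ℂ^(n+1)`: the powers `z_j ^ a_j`, viewed as vectors of the Euclidean plane,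
are pairwise neither parallel nor orthogonal, that is, `mixedPower a j k z` is neither real nor
imaginary. -/
def IsGeneric (a : Fin (n + 1) → ℕ) (z : Fin (n + 1) → ℂ) : Prop :=
  ∀ j k, j ≠ k → (mixedPower a j k z ^ 2).im ≠ 0

theorem IsGeneric.re_ne_zero (h : IsGeneric a z) (hjk : j ≠ k) : (mixedPower a j k z).re ≠ 0 :=
  fun h0 => h j k hjk (by rw [im_complex_sq, h0, mul_zero, zero_mul])

theorem IsGeneric.im_ne_zero (h : IsGeneric a z) (hjk : j ≠ k) : (mixedPower a j k z).im ≠ 0 :=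
  fun h0 => h j k hjk (by rw [im_complex_sq, h0, mul_zero])

theorem IsGeneric.ne_zero [Nontrivial (Fin (n + 1))] (h : IsGeneric a z) (ha : ∀ j, 0 < a j)
    (j : Fin (n + 1)) : z j ≠ 0 := by
  obtain ⟨k, hk⟩ := exists_ne j
  exact fun h0 => h.re_ne_zero hk.symm (by simp [mixedPower, h0, (ha j).ne'])

theorem exists_mem_tangent_apply_ne_zero (ha : ∀ j, 0 < a j)
    (hz : z ∈ carrier (definingMap a)) (hj : z j = 0) :
    ∃ v ∈ tangent (definingMap a) z, v j ≠ 0 := by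
  obtain ⟨k, hk⟩ := exists_ne_zero_of_mem_carrier hz
  have hkj : k ≠ j := fun h => hk (h ▸ hj)
  -- `z_j ^ (a_j - 1)` is `1` if `a_j = 1` and `0` otherwise.
  obtain ⟨c, hc⟩ : ∃ c : ℝ, z j ^ (a j - 1) = c := ⟨0 ^ (a j - 1), by simp [hj]⟩
  have hak : (a k : ℂ) ≠ 0 := Nat.cast_ne_zero.2 (ha k).ne'
  refine ⟨Pi.single j (Complex.I * a k * z k ^ a k) - Pi.single k (Complex.I * a j * c * z k),
    (mem_tangent_definingMap_iff ha).2 ⟨?_, ?_⟩, ?_⟩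
  · have hkk : conj (z k) * (Complex.I * a j * c * z k) =
        ((a j * c * ‖z k‖ ^ 2 : ℝ) : ℂ) * Complex.I := by
      push_cast
      rw [← Complex.conj_mul']
      ring
    have hsum : weightedForm a (weightedPoint a z) (Pi.single j (Complex.I * a k * z k ^ a k) -
        Pi.single k (Complex.I * a j * c * z k)) = -(conj (z k) * (Complex.I * a j * c * z k)) := by
      simp [weightedForm_weightedPoint ha, mul_sub, Finset.sum_sub_distrib, Pi.single_apply, hj]
    rw [hsum, hkk, Complex.neg_re, Complex.re_ofReal_mul, Complex.I_re, mul_zero, neg_zero]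
  · rw [map_sub, weightedForm_single, weightedForm_single, powerGradient, powerGradient,
      Complex.conj_conj, Complex.conj_conj, hc, ← pow_sub_one_mul (ha k).ne' (z k)]
    ring
  · simp [hkj.symm, hk, hak]

theorem dense_coord_ne_zero (ha : ∀ j, 0 < a j) (j : Fin (n + 1)) :
    Dense {z : carrier (definingMap a) | z.1 j ≠ 0} := by
  refine (isRegular_definingMap ha).dense_ne_zero (h := fun z => z j) dense_univ fun z _ hj => ?_
  obtain ⟨v, hv, hne⟩ := exists_mem_tangent_apply_ne_zero ha z.2 hj
  have hcoord := hasFDerivAt_apply (𝕜 := ℝ) (F' := fun _ => ℂ) j z.1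
  exact ⟨v, hv, by simpa [hcoord.fderiv] using hne⟩

theorem dense_forall_coord_ne_zero (ha : ∀ j, 0 < a j) :
    Dense {z : carrier (definingMap a) | ∀ j, z.1 j ≠ 0} := by
  rw [Set.ofPred_forall]
  refine dense_iInter_of_isOpen_of_finite (fun j => ?_) fun j => dense_coord_ne_zero ha j
  exact isOpen_ne_fun ((continuous_apply j).comp continuous_subtype_val) continuous_const

theorem exists_logVector_mem_tangent (hn : 2 ≤ n) (ha : ∀ j, 0 < a j)
    (hz : z ∈ carrier (definingMap a)) (h0 : ∀ j, z j ≠ 0) (hjk : j ≠ k) :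
    ∃ ζ, logVector a z ζ ∈ tangent (definingMap a) z ∧ (ζ j + conj (ζ k)).im = 1 := by
  obtain ⟨l, hl⟩ : ∃ l, l ∉ ({j, k} : Finset (Fin (n + 1))) := by
    refine Finset.exists_mem_notMem_of_card_lt_card (s := {j, k}) (t := Finset.univ) ?_ |>.imp
      fun _ => And.right
    rw [Finset.card_pair hjk, Finset.card_fin]
    lia
  simp only [Finset.mem_insert, Finset.mem_singleton, not_or] at hl
  have hPl : z l ^ a l ≠ 0 := pow_ne_zero _ (h0 l)
  have hpos : 0 < ∑ i, ‖z i‖ ^ 2 / (a i : ℝ) :=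
    Finset.sum_pos (fun i _ => div_pos (pow_pos (norm_pos_iff.2 (h0 i)) 2)
      (Nat.cast_pos.2 (ha i))) Finset.univ_nonempty
  let ξ : Fin (n + 1) → ℂ :=
    Pi.single j Complex.I - Pi.single l (Complex.I * z j ^ a j / z l ^ a l)
  have hξ : ∑ i, ξ i * z i ^ a i = 0 := by
    simp [ξ, sub_mul, Finset.sum_sub_distrib, Pi.single_apply, div_mul_cancel₀ _ hPl]
  have hξjk : (ξ j).im = 1 ∧ (ξ k).im = 0 := by
    simp [ξ, hl.1, hl.2, hjk, Ne.symm]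
  let c : ℝ := (∑ i, ‖z i‖ ^ 2 / a i * (ξ i).re) / ∑ i, ‖z i‖ ^ 2 / (a i : ℝ)
  refine ⟨fun i => ξ i - c, (logVector_mem_tangent_iff ha).2 ⟨?_, ?_⟩, ?_⟩
  · simp only [Complex.sub_re, Complex.ofReal_re, mul_sub, Finset.sum_sub_distrib]
    rw [← Finset.sum_mul, mul_div_cancel₀ _ hpos.ne', sub_self]
  · simp only [sub_mul, Finset.sum_sub_distrib]
    rw [hξ, ← Finset.mul_sum, (mem_carrier_iff.1 hz).2, mul_zero, sub_zero]
  · simp [hξjk]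

theorem isOpen_im_mixedPower_sq_ne_zero (j k : Fin (n + 1)) :
    IsOpen {z : carrier (definingMap a) | (mixedPower a j k z ^ 2).im ≠ 0} :=
  isOpen_ne_fun (Complex.continuous_im.comp
    (((contDiff_mixedPower j k).continuous.comp continuous_subtype_val).pow 2)) continuous_const

theorem dense_im_mixedPower_sq_ne_zero (hn : 2 ≤ n) (ha : ∀ j, 0 < a j) (hjk : j ≠ k) :
    Dense {z : carrier (definingMap a) | (mixedPower a j k z ^ 2).im ≠ 0} := by
  refine (isRegular_definingMap ha).dense_ne_zero (h := fun z => (mixedPower a j k z ^ 2).im)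
    (dense_forall_coord_ne_zero ha) fun z h0 him => ?_
  obtain ⟨ζ, hv, hζ⟩ := exists_logVector_mem_tangent hn ha z.2 h0 hjk
  have hdiff : Differentiable ℝ fun z => (mixedPower a j k z ^ 2).im :=
    (Complex.imCLM.contDiff.comp ((contDiff_mixedPower j k).pow 2)).differentiable (by simp)
  have hne : mixedPower a j k z ≠ 0 := by simp [mixedPower, h0 j, h0 k]
  have hre : (mixedPower a j k z ^ 2).re ≠ 0 := fun hre => pow_ne_zero 2 hne (Complex.ext hre him)
  have hderiv : HasDerivAt (fun t => mixedPower a j k (logCurve a z ζ t) ^ 2)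
      ((2 : ℝ) * ((ζ j + conj (ζ k)) * mixedPower a j k z ^ 2)) 0 := by
    simp only [mixedPower_logCurve ha]
    refine (((hasDerivAt_exp_ofReal_mul _).mul_const _).fun_pow 2).congr_deriv ?_
    simp only [Nat.cast_ofNat, Complex.ofReal_ofNat, Complex.ofReal_zero, zero_mul,
      Complex.exp_zero, one_mul, Nat.add_one_sub_one, pow_one]
    ring
  refine ⟨_, hv, ?_⟩
  rw [fderiv_apply_logVector (hdiff z) (Complex.imCLM.hasFDerivAt.comp_hasDerivAt (0 : ℝ) hderiv),
    Complex.imCLM_apply, Complex.im_ofReal_mul, Complex.mul_im, him, hζ, mul_zero, zero_add,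
    one_mul]
  exact mul_ne_zero two_ne_zero hre

theorem setOf_isGeneric_eq_iInter :
    {z : carrier (definingMap a) | IsGeneric a z} =
      ⋂ p : {p : Fin (n + 1) × Fin (n + 1) // p.1 ≠ p.2},
        {z : carrier (definingMap a) | (mixedPower a p.1.1 p.1.2 z ^ 2).im ≠ 0} := by
  ext z
  simp [IsGeneric]

theorem isOpen_setOf_isGeneric : IsOpen {z : carrier (definingMap a) | IsGeneric a z} := by
  rw [setOf_isGeneric_eq_iInter]
  exact isOpen_iInter_of_finite fun p => isOpen_im_mixedPower_sq_ne_zero p.1.1 p.1.2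

theorem dense_setOf_isGeneric (hn : 2 ≤ n) (ha : ∀ j, 0 < a j) :
    Dense {z : carrier (definingMap a) | IsGeneric a z} := by
  rw [setOf_isGeneric_eq_iInter]
  exact dense_iInter_of_isOpen_of_finite
    (fun p => isOpen_im_mixedPower_sq_ne_zero p.1.1 p.1.2)
    fun p => dense_im_mixedPower_sq_ne_zero hn ha p.2

end GenericPoints

section Independence

variable {ζ : Fin (n + 1) → ℂ} {j k o r s : Fin (n + 1)}

theorem re_eq_zero_of_deriveAlong_coordIntegral (ha : ∀ j, 0 < a j)
    (hz : z ∈ carrier (definingMap a)) (h0 : ∀ j, z j ≠ 0)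
    (hv : logVector a z ζ ∈ tangent (definingMap a) z)
    (h : ∀ j, j ≠ o → deriveAlong (definingMap a) (coordIntegral j) z (logVector a z ζ) = 0)
    (j : Fin (n + 1)) : (ζ j).re = 0 := by
  have hpos (j : Fin (n + 1)) : ‖z j‖ ^ 2 / (a j : ℝ) ≠ 0 :=
    div_ne_zero (pow_ne_zero 2 (norm_ne_zero_iff.2 (h0 j))) (Nat.cast_ne_zero.2 (ha j).ne')
  have hne (j : Fin (n + 1)) (hj : j ≠ o) : (ζ j).re = 0 := by
    have hj' := h j hj
    rw [deriveAlong_coordIntegral_logVector ha hz j hv] at hj'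
    simpa [hpos j] using hj'
  obtain rfl | hj := eq_or_ne j o
  · have hsum := ((logVector_mem_tangent_iff ha).1 hv).1
    rw [Fintype.sum_eq_single j fun k hk => by rw [hne k hk, mul_zero]] at hsum
    exact (mul_eq_zero.1 hsum).resolve_left (hpos j)
  · exact hne j hj

theorem im_eq_of_deriveAlong_bracketIntegral (ha : ∀ j, 0 < a j)
    (hz : z ∈ carrier (definingMap a)) (hre : (mixedPower a j k z).re ≠ 0)
    (hζ : ∀ j, (ζ j).re = 0) (hv : logVector a z ζ ∈ tangent (definingMap a) z)
    (h : deriveAlong (definingMap a) (bracketIntegral a j k) z (logVector a z ζ) = 0) :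
    (ζ j).im = (ζ k).im := by
  rw [deriveAlong_bracketIntegral_logVector ha hz j k hζ hv,
    div_eq_zero_iff, or_iff_left (gradientSq_pos ha hz).ne', Complex.mul_im] at h
  simpa [hζ, hre, ← sub_eq_add_neg, sub_eq_zero] using h

theorem im_eq_of_im_mixedPower_ne_zero (hz : z ∈ carrier (definingMap a)) (hrs : r ≠ s)
    (him : (mixedPower a r s z).im ≠ 0) (hζ : ∀ j, (ζ j).re = 0)
    (hsum : ∑ j, ζ j * z j ^ a j = 0) {c : ℝ} (hc : ∀ j, j ≠ r → j ≠ s → (ζ j).im = c)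
    (j : Fin (n + 1)) : (ζ j).im = c := by
  have hterm (j : Fin (n + 1)) : Complex.I * (((ζ j).im - c) • z j ^ a j) =
      ζ j * z j ^ a j - c * Complex.I * z j ^ a j := by
    have hj : ζ j = (ζ j).im * Complex.I := by apply Complex.ext <;> simp [hζ]
    rw [Complex.real_smul]
    push_cast
    linear_combination -z j ^ a j * hj
  have hzero : ∑ j, ((ζ j).im - c) • z j ^ a j = 0 := by
    refine (mul_eq_zero.1 ?_).resolve_left Complex.I_ne_zero
    rw [Finset.mul_sum, Finset.sum_congr rfl fun j _ => hterm j, Finset.sum_sub_distrib, hsum,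
      ← Finset.mul_sum, (mem_carrier_iff.1 hz).2, mul_zero, sub_zero]
  rw [Fintype.sum_eq_add r s hrs fun j hj => by rw [hc j hj.1 hj.2, sub_self, zero_smul]] at hzero
  obtain ⟨hr, hs⟩ := LinearIndependent.pair_iff.1 (linearIndependent_pair_of_im_ne_zero him)
    _ _ hzero
  obtain rfl | hjr := eq_or_ne j r
  · exact sub_eq_zero.1 hr
  obtain rfl | hjs := eq_or_ne j s
  · exact sub_eq_zero.1 hs
  · exact hc j hjr hjs

theorem logVector_eq_smul_reebField (hζ : ∀ j, (ζ j).re = 0) {c : ℝ} (hc : ∀ j, (ζ j).im = c) :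
    logVector a z ζ = (c / 4) • reebField a z := by
  have hζ' : ζ = fun _ => c * Complex.I := funext fun j => by apply Complex.ext <;> simp [hζ, hc]
  ext j
  rw [hζ', logVector, Pi.smul_apply, reebField, Complex.real_smul]
  push_cast
  ring

/-- The functions `f_j` for `j ≠ o` together with the brackets `[f_o, f_k]` for `k ∉ {o, r, s}`. -/
def independentIntegrals (a : Fin (n + 1) → ℕ) (o r s : Fin (n + 1)) :
    {j // j ≠ o} ⊕ {k // k ∉ ({o, r, s} : Finset (Fin (n + 1)))} → (Fin (n + 1) → ℂ) → ℝ :=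
  Sum.elim (fun j => coordIntegral j.1) fun k => bracketIntegral a o k.1

theorem independentIntegrals_mem (i) : independentIntegrals a o r s i ∈ integrals a := by
  obtain j | k := i
  · exact Or.inl ⟨j, rfl⟩
  · exact Or.inr ⟨o, k, rfl⟩

theorem mem_span_reebField (ha : ∀ j, 0 < a j) (hz : z ∈ carrier (definingMap a))
    (hgen : IsGeneric a z) (hrs : r ≠ s) (hro : r ≠ o) (hso : s ≠ o)
    (hv : v ∈ tangent (definingMap a) z)
    (h : ∀ i, deriveAlong (definingMap a) (independentIntegrals a o r s i) z v = 0) :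
    v ∈ Submodule.span ℝ {reebField a z} := by
  have : Nontrivial (Fin (n + 1)) := ⟨r, s, hrs⟩
  have h0 := hgen.ne_zero ha
  obtain ⟨ζ, rfl⟩ := exists_eq_logVector ha h0 v
  have hre : ∀ j, (ζ j).re = 0 :=
    re_eq_zero_of_deriveAlong_coordIntegral ha hz h0 hv fun j hj => h (Sum.inl ⟨j, hj⟩)
  have hbracket (k : Fin (n + 1)) (hkr : k ≠ r) (hks : k ≠ s) : (ζ k).im = (ζ o).im := by
    obtain rfl | hko := eq_or_ne k o
    · rfl
    · exact (im_eq_of_deriveAlong_bracketIntegral ha hz (hgen.re_ne_zero hko.symm) hre hv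
        (h (Sum.inr ⟨k, by simp [hko, hkr, hks]⟩))).symm
  have him : ∀ j, (ζ j).im = (ζ o).im := im_eq_of_im_mixedPower_ne_zero hz hrs
    (hgen.im_ne_zero hrs) hre ((logVector_mem_tangent_iff ha).1 hv).2 hbracket
  exact Submodule.mem_span_singleton.2 ⟨_, (logVector_eq_smul_reebField hre him).symm⟩

theorem card_independentIntegrals_index (hrs : r ≠ s) (hro : r ≠ o) (hso : s ≠ o) :
    Fintype.card ({j // j ≠ o} ⊕ {k // k ∉ ({o, r, s} : Finset (Fin (n + 1)))}) = 2 * n - 2 := by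
  have hthree : ({o, r, s} : Finset (Fin (n + 1))).card = 3 :=
    Finset.card_eq_three.2 ⟨o, r, s, hro.symm, hso.symm, hrs, rfl⟩
  rw [Fintype.card_sum, Fintype.card_subtype_compl, Fintype.card_subtype_compl,
    Fintype.card_subtype_eq, Fintype.card_coe, Fintype.card_fin, hthree]
  have := hthree ▸ Finset.card_le_univ ({o, r, s} : Finset (Fin (n + 1)))
  rw [Fintype.card_fin] at this
  lia

theorem linearIndependent_independentIntegrals (ha : ∀ j, 0 < a j)
    (hz : z ∈ carrier (definingMap a)) (hgen : IsGeneric a z) (hrs : r ≠ s)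
    (hro : r ≠ o) (hso : s ≠ o) : LinearIndependent ℝ fun i =>
      differential (definingMap a) (independentIntegrals a o r s i) z := by
  let R : tangent (definingMap a) z := ⟨reebField a z, (isReebAt_reebField ha hz).1⟩
  refine linearIndependent_of_card_add_finrank_le (p := Submodule.span ℝ {R})
    (fun v hv => ?_) ?_
  · have hspan := mem_span_reebField ha hz hgen hrs hro hso v.2 fun i => by
      rw [deriveAlong, dif_pos v.2]
      exact hv i
    obtain ⟨c, hc⟩ := Submodule.mem_span_singleton.1 hspan
    exact Submodule.mem_span_singleton.2 ⟨c, Subtype.ext hc⟩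
  · have hcard := card_independentIntegrals_index hrs hro hso
    have hdim := finrank_tangent ha hz
    have hR : Module.finrank ℝ (Submodule.span ℝ {R}) ≤ 1 := by
      simpa using finrank_span_le_card (R := ℝ) ({R} : Set (tangent (definingMap a) z))
    lia

theorem exists_independent_integrals (ha : ∀ j, 0 < a j) :
    ∃ g : Fin (2 * n - 2) → (Fin (n + 1) → ℂ) → ℝ,
      (∀ i, g i ∈ integrals a) ∧ AreIndependent (definingMap a) g := by
  obtain hn | hn := lt_or_ge n 2
  · have : IsEmpty (Fin (2 * n - 2)) := Fintype.card_eq_zero_iff.1 (by rw [Fintype.card_fin]; lia)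
    exact ⟨isEmptyElim, isEmptyElim, Set.univ, isOpen_univ, dense_univ,
      fun z _ => linearIndependent_empty_type⟩
  obtain ⟨o, r, s, hor, hos, hrs⟩ : ∃ o r s : Fin (n + 1), o ≠ r ∧ o ≠ s ∧ r ≠ s :=
    Fintype.two_lt_card_iff.1 (by rw [Fintype.card_fin]; lia)
  let e := (Fintype.equivFinOfCardEq (card_independentIntegrals_index hrs hor.symm hos.symm)).symm
  exact ⟨fun i => independentIntegrals a o r s (e i), fun i => independentIntegrals_mem (e i),
    {z | IsGeneric a z}, isOpen_setOf_isGeneric, dense_setOf_isGeneric hn ha, fun z hz =>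
      (linearIndependent_independentIntegrals ha z.2 hz hrs hor.symm hos.symm).comp e e.injective⟩

end Independence

end Brieskorn

end

theorem proposition4p2 (n : ℕ) (hn : 1 ≤ n) (a : Fin (n + 1) → ℕ) (ha : ∀ j, 0 < a j) :
    ContactLevelSet.IsContactForm (Brieskorn.definingMap a) (Brieskorn.contactForm a) (n - 1) ∧
    (∀ z ∈ ContactLevelSet.carrier (Brieskorn.definingMap a),
      ContactLevelSet.IsReebAt (Brieskorn.definingMap a) (Brieskorn.contactForm a) z
        (Brieskorn.reebField a z)) ∧
    ContactLevelSet.IsCompleteNoncommutative (Brieskorn.definingMap a) (Brieskorn.contactForm a)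
      (n - 1) 0 (Brieskorn.integrals a) ∧
    ∃ g : Fin (2 * n - 2) → (Fin (n + 1) → ℂ) → ℝ,
      (∀ i, g i ∈ Brieskorn.integrals a) ∧
      ContactLevelSet.AreIndependent (Brieskorn.definingMap a) g := by
  have hreeb z (hz : z ∈ ContactLevelSet.carrier (Brieskorn.definingMap a)) :=
    Brieskorn.isReebAt_reebField ha hz
  obtain ⟨g, hg, hindep⟩ := Brieskorn.exists_independent_integrals ha
  refine ⟨Brieskorn.isContactForm_contactForm ha, hreeb, ⟨Nat.zero_le _,
    fun f hf => Brieskorn.isReebIntegral_of_mem_integrals ha hf, ?_⟩, g, hg, hindep⟩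
  rw [show 2 * (n - 1) - 0 = 2 * n - 2 by lia]
  exact ⟨g, hg, hindep, fun i j hj => absurd hj (Nat.not_lt_zero _)⟩
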